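/- Let $n\ge 1$, let $A\in\mathbb C^{n\times n}$ be Hermitian, and let $\mathcal X,\mathcal Y\subseteq\mathbb C^n$ be subspaces of the same dimension $k$, with orthonormal bases given by the columns of the matrices $X,Y\in\mathbb C^{n\times k}$ respectively. For a Hermitian matrix $B$ let $\lambda(B)$ be the vector of its eigenvalues, counted with multiplicity, in descending order, and put $\operatorname{spr}(A)=\lambda_1(A)-\lambda_n(A)$. Let $\theta(\mathcal X,\mathcal Y)\in[0,\pi/2]^k$ be the vector of principal angles in descending order, defined by the condition that $\cos\theta(\mathcal X,\mathcal Y)$ is the vector of the $k$ singular values of $X^HY$ in ascending order. For $x,y\in\mathbb R^k$ write $x\prec_w y$ if $\sum_{i=1}^j x_i^{\downarrow}\le\sum_{i=1}^j y_i^{\downarrow}$ for $1\le j\le k$, where $x^{\downarrow}$ is $x$ with its entries in descending order. Suppose that one of the subspaces $\mathcal X$, $\mathcal Y$, call it $\mathcal Z$, is $A$-invariant, and that at least one of the following holds: (a) $\mathcal Z$ corresponds to a contiguous set of the largest (or of the smallest) eigenvalues of $A$; that is, there is an orthonormal basis $u_1,\dots,u_n$ of $\mathbb C^n$ with $Au_i=\lambda_i(A)u_i$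 for all $i$ such that $\mathcal Z=\operatorname{span}\{u_1,\dots,u_k\}$ (or $\mathcal Z=\operatorname{span}\{u_{n-k+1},\dots,u_n\}$); (b) all the eigenvalues of $A$ corresponding to $\mathcal Z$ (those having an eigenvector in $\mathcal Z$) lie in $[\tfrac12(\lambda_1(A)+\lambda_n(A)),\lambda_1(A)]$, or all of them lie in $[\lambda_n(A),\tfrac12(\lambda_1(A)+\lambda_n(A))]$. Then $$|\lambda(X^HAX)-\lambda(Y^HAY)|\prec_w\operatorname{spr}(A)\,\sin^2\theta(\mathcal X,\mathcal Y),$$ where absolute value, sine and square are taken entrywise. -/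

import Mathlib

noncomputable section RitzDefs

/-- The vector `λ(A)` of the eigenvalues of a Hermitian `n × n` matrix, with multiplicity, in
descending order. The indices start at zero: `eigDesc hA 0` is `λ₁(A)`. -/
def eigDesc {n : ℕ} {A : Matrix (Fin n) (Fin n) ℂ} (hA : A.IsHermitian) : Fin n → ℝ :=
  fun i => hA.eigenvalues₀ (Fin.cast (Fintype.card_fin n).symm i)

/-- The largest eigenvalue `λ₁(A)`. -/
def eigMax {n : ℕ} [NeZero n] {A : Matrix (Fin n) (Fin n) ℂ} (hA : A.IsHermitian) : ℝ :=
  eigDesc hA 0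

/-- The smallest eigenvalue `λₙ(A)`. -/
def eigMin {n : ℕ} [NeZero n] {A : Matrix (Fin n) (Fin n) ℂ} (hA : A.IsHermitian) : ℝ :=
  eigDesc hA (Fin.rev 0)

/-- The spread `spr(A) = λ₁(A) - λₙ(A)`. -/
def spr {n : ℕ} [NeZero n] {A : Matrix (Fin n) (Fin n) ℂ} (hA : A.IsHermitian) : ℝ :=
  eigMax hA - eigMin hA

/-- The columns of `X` form an orthonormal basis of the subspace `𝒳` of `ℂⁿ`. -/
def IsOrthonormalBasisMatrix {n k : ℕ} (X : Matrix (Fin n) (Fin k) ℂ)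
    (𝒳 : Submodule ℂ (EuclideanSpace ℂ (Fin n))) : Prop :=
  Orthonormal ℂ (fun j => WithLp.toLp 2 (X.col j) : Fin k → EuclideanSpace ℂ (Fin n)) ∧
    Submodule.span ℂ
      (Set.range (fun j => WithLp.toLp 2 (X.col j) : Fin k → EuclideanSpace ℂ (Fin n))) = 𝒳

/-- The Ritz values `λ(Xᴴ A X)`, in descending order. -/
def ritzValues {n k : ℕ} {A : Matrix (Fin n) (Fin n) ℂ} (hA : A.IsHermitian)
    (X : Matrix (Fin n) (Fin k) ℂ) : Fin k → ℝ :=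
  eigDesc (Matrix.isHermitian_conjTranspose_mul_mul X hA)

/-- The vector `θ` of principal angles, in descending order, between the column spaces of `X` and
`Y`, matrices with orthonormal columns: `cos θ` is the vector of the `k` singular values of
`Xᴴ Y` in ascending order, and the angles lie in `[0, π/2]`. -/
def principalAngles {n k : ℕ} (X Y : Matrix (Fin n) (Fin k) ℂ) : Fin k → ℝ :=
  fun i => Real.arccos ((Matrix.toEuclideanLin (X.conjTranspose * Y)).singularValues (Fin.rev i))

/-- The rearrangement `x↓` of a real vector in descending order. -/
def descending {m : ℕ} (x : Fin m → ℝ) : Fin m → ℝ :=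
  fun i => x (Tuple.sort x (Fin.rev i))

/-- Weak (sub-)majorization `x ≺_w y`. -/
def WeakMajorized {m : ℕ} (x y : Fin m → ℝ) : Prop :=
  ∀ j : Fin m, ∑ i ∈ Finset.Iic j, descending x i ≤ ∑ i ∈ Finset.Iic j, descending y i

/-- The subspace `𝒳` is `A`-invariant. -/
def IsInvariantSubspace {n : ℕ} (A : Matrix (Fin n) (Fin n) ℂ)
    (𝒳 : Submodule ℂ (EuclideanSpace ℂ (Fin n))) : Prop :=
  ∀ v ∈ 𝒳, Matrix.toEuclideanLin A v ∈ 𝒳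

/-- The real number `μ` is an eigenvalue of `A` with an eigenvector in `𝒳`. For an invariant
subspace these are the eigenvalues of `A` corresponding to it. -/
def IsEigenvalueOn {n : ℕ} (A : Matrix (Fin n) (Fin n) ℂ)
    (𝒳 : Submodule ℂ (EuclideanSpace ℂ (Fin n))) (μ : ℝ) : Prop :=
  ∃ v ∈ 𝒳, v ≠ 0 ∧ Matrix.toEuclideanLin A v = (μ : ℂ) • v

/-- `𝒳` corresponds to a contiguous set `λ₁(A), …, λ_m(A)` of the largest eigenvalues of `A`,
counted with multiplicity: it is spanned by the matching members of some orthonormal basis of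
eigenvectors. -/
def CorrespondsToLargest {n : ℕ} {A : Matrix (Fin n) (Fin n) ℂ} (hA : A.IsHermitian)
    (𝒳 : Submodule ℂ (EuclideanSpace ℂ (Fin n))) : Prop :=
  ∃ (u : OrthonormalBasis (Fin n) ℂ (EuclideanSpace ℂ (Fin n))) (m : ℕ),
    (∀ i, Matrix.toEuclideanLin A (u i) = (eigDesc hA i : ℂ) • u i) ∧
    𝒳 = Submodule.span ℂ (u '' {i | (i : ℕ) < m})

/-- `𝒳` corresponds to a contiguous set `λ_{m+1}(A), …, λₙ(A)` of the smallest eigenvalues of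
`A`, counted with multiplicity. -/
def CorrespondsToSmallest {n : ℕ} {A : Matrix (Fin n) (Fin n) ℂ} (hA : A.IsHermitian)
    (𝒳 : Submodule ℂ (EuclideanSpace ℂ (Fin n))) : Prop :=
  ∃ (u : OrthonormalBasis (Fin n) ℂ (EuclideanSpace ℂ (Fin n))) (m : ℕ),
    (∀ i, Matrix.toEuclideanLin A (u i) = (eigDesc hA i : ℂ) • u i) ∧
    𝒳 = Submodule.span ℂ (u '' {i | m ≤ (i : ℕ)})

/-- All eigenvalues of `A` on `𝒳` lie between one extreme eigenvalue of `A` and the midpoint of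
the spectrum of `A`, both included. -/
def InHalfSpectrum {n : ℕ} [NeZero n] {A : Matrix (Fin n) (Fin n) ℂ} (hA : A.IsHermitian)
    (𝒳 : Submodule ℂ (EuclideanSpace ℂ (Fin n))) : Prop :=
  (∀ μ, IsEigenvalueOn A 𝒳 μ → μ ∈ Set.Icc ((eigMax hA + eigMin hA) / 2) (eigMax hA)) ∨
  (∀ μ, IsEigenvalueOn A 𝒳 μ → μ ∈ Set.Icc (eigMin hA) ((eigMax hA + eigMin hA) / 2))

end RitzDefs

/-! Weak majorization by a nonnegative vector follows from the hinge inequalities `∑ (xᵢ - t)₊ ≤ ∑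
(yᵢ - t)₊` for all `t ≥ 0` (`weakMajorized_of_sum_hinge_le`). These ignore ordering and add up well,
so all estimates are made in that form.

Let `X` span the invariant subspace, and put `M = Xᴴ A X`, `C = Xᴴ Y`, `R = Y - X C`. Then `Rᴴ R = 1
- Cᴴ C` has eigenvalues `sin² θ`, and invariance removes the cross terms: `Yᴴ A Y = Cᴴ M C + Rᴴ A R`
(`compression_eq_add`). If `0 ≤ M ≤ u`, passing from `M` to `Cᴴ M C` lowers the eigenvalues by
amounts weakly majorized by `u sin² θ` (`eigDesc_compression`). This rests on a Lidskii–Mirsky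
inequality (`sum_hinge_abs_eigDesc_sub_le`), itself derived from Weyl monotonicity, traces and
Schur–Horn.

Extremal eigenvalues: shift `A` so that `0 ≤ A ≤ spr A`. Then `Rᴴ A R ≥ 0` gives `λ(Cᴴ M C) ≤ λ(Yᴴ A
Y)`, and separation of the spectrum gives `λ(Yᴴ A Y) ≤ λ(M)`. The compression bound with `u = spr A`
therefore suffices.

Half spectrum: shift the midpoint to `0`, so that `-h ≤ A ≤ h` with `h = spr A / 2` and `M ≥ 0`.
Compression costs `h sin² θ`; adding `Rᴴ A R`, which lies between `±h Rᴴ R`, costs another `h sin²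
θ`.

The lower end of the spectrum is treated by replacing `A` with `-A`. -/

open Matrix
open scoped ComplexOrder

/-! ### Real quadratic forms and the Loewner order. -/

section Quad

variable {n k : ℕ}

/-- The real part of the quadratic form `vᴴ M v`. -/
noncomputable def quad (M : Matrix (Fin n) (Fin n) ℂ) (v : Fin n → ℂ) : ℝ :=
  (star v ⬝ᵥ M *ᵥ v).re

theorem quad_add (M N : Matrix (Fin n) (Fin n) ℂ) (v : Fin n → ℂ) :
    quad (M + N) v = quad M v + quad N v := by
  simp [quad, add_mulVec, dotProduct_add]

theorem quad_sub (M N : Matrix (Fin n) (Fin n) ℂ) (v : Fin n → ℂ) :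
    quad (M - N) v = quad M v - quad N v := by
  simp [quad, sub_mulVec, dotProduct_sub]

theorem quad_neg (M : Matrix (Fin n) (Fin n) ℂ) (v : Fin n → ℂ) :
    quad (-M) v = - quad M v := by
  simp [quad, neg_mulVec]

theorem quad_smul (c : ℝ) (M : Matrix (Fin n) (Fin n) ℂ) (v : Fin n → ℂ) :
    quad ((c : ℂ) • M) v = c * quad M v := by
  simp [quad, smul_mulVec, dotProduct_smul]

theorem quad_one (v : Fin n → ℂ) :
    quad (1 : Matrix (Fin n) (Fin n) ℂ) v = ∑ i, Complex.normSq (v i) := by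
  simp [quad, dotProduct, Complex.normSq_apply]

theorem quad_one_pos {v : Fin n → ℂ} (hv : v ≠ 0) :
    0 < quad (1 : Matrix (Fin n) (Fin n) ℂ) v := by
  rw [quad_one]
  obtain ⟨i, hi⟩ := Function.ne_iff.mp hv
  exact Finset.sum_pos' (fun i _ => Complex.normSq_nonneg _)
    ⟨i, Finset.mem_univ _, Complex.normSq_pos.mpr hi⟩

theorem quad_conj (M : Matrix (Fin n) (Fin n) ℂ) (C : Matrix (Fin n) (Fin k) ℂ)
    (v : Fin k → ℂ) : quad (Cᴴ * M * C) v = quad M (C *ᵥ v) := by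
  simp [quad, ← mulVec_mulVec, star_mulVec, dotProduct_mulVec, vecMul_vecMul, Matrix.mul_assoc]

theorem quad_diagonal (d : Fin n → ℝ) (v : Fin n → ℂ) :
    quad (diagonal fun i => (d i : ℂ)) v = ∑ i, d i * Complex.normSq (v i) := by
  simp only [quad, dotProduct, mulVec_diagonal, Complex.re_sum, Pi.star_apply]
  refine Finset.sum_congr rfl fun i _ => ?_
  simp [Complex.normSq_apply]
  ring

theorem Matrix.PosSemidef.quad_nonneg {M : Matrix (Fin n) (Fin n) ℂ} (hM : M.PosSemidef)
    (v : Fin n → ℂ) : 0 ≤ quad M v :=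
  (Complex.le_def.mp (hM.dotProduct_mulVec_nonneg v)).1

theorem Matrix.IsHermitian.posSemidef_of_quad_nonneg {M : Matrix (Fin n) (Fin n) ℂ}
    (hM : M.IsHermitian) (h : ∀ v, 0 ≤ quad M v) : M.PosSemidef := by
  refine PosSemidef.of_dotProduct_mulVec_nonneg hM fun v => ?_
  refine Complex.le_def.mpr ⟨h v, ?_⟩
  have := hM.im_star_dotProduct_mulVec_self v
  simpa using this.symm

theorem isHermitian_real_smul_one (c : ℝ) :
    ((c : ℂ) • (1 : Matrix (Fin n) (Fin n) ℂ)).IsHermitian := by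
  simp [IsHermitian, conjTranspose_smul]

theorem Matrix.IsHermitian.real_smul {M : Matrix (Fin n) (Fin n) ℂ} (hM : M.IsHermitian) (c : ℝ) :
    ((c : ℂ) • M).IsHermitian := by
  simp [IsHermitian, conjTranspose_smul, hM.eq]

end Quad

/-! ### Ordered eigenvalues: diagonalization, affine changes, Weyl monotonicity. -/

section EigDesc

variable {n : ℕ} {M N : Matrix (Fin n) (Fin n) ℂ}

theorem eigDesc_antitone (hM : M.IsHermitian) : Antitone (eigDesc hM) :=
  fun _ _ hij => hM.eigenvalues₀_antitone (by simpa using! hij)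

/-- Used mainly to identify the spectra of `S T` and `T S` for square factors. -/
theorem eigDesc_eq_of_charpoly_eq (hM : M.IsHermitian) (hN : N.IsHermitian)
    (h : M.charpoly = N.charpoly) : eigDesc hM = eigDesc hN := by
  have : hM.eigenvalues₀ = hN.eigenvalues₀ := by
    simp_rw [← List.ofFn_inj, ← IsHermitian.sort_roots_charpoly_eq_eigenvalues₀, h]
  unfold eigDesc
  rw [this]

theorem eigDesc_congr (hM : M.IsHermitian) (hN : N.IsHermitian) (h : M = N) :
    eigDesc hM = eigDesc hN :=
  eigDesc_eq_of_charpoly_eq hM hN (by rw [h])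

theorem exists_unitary_diagonalization (hM : M.IsHermitian) :
    ∃ U : Matrix (Fin n) (Fin n) ℂ, Uᴴ * U = 1 ∧
      M = U * (diagonal fun i => (eigDesc hM i : ℂ)) * Uᴴ := by
  -- Mathlib's eigenvector matrix is indexed through an arbitrary equivalence; permuting its columns
  -- by `σ` puts the eigenvalues in descending order.
  let σ : Fin n ≃ Fin n := (finCongr (Fintype.card_fin n).symm).trans
    (Fintype.equivOfCardEq (Fintype.card_fin _))
  have hσ : ∀ i, eigDesc hM i = hM.eigenvalues (σ i) := fun i => by
    simp [eigDesc, IsHermitian.eigenvalues, σ]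
  let V : Matrix (Fin n) (Fin n) ℂ := hM.eigenvectorUnitary
  have hV : Vᴴ * V = 1 := Unitary.coe_star_mul_self hM.eigenvectorUnitary
  have hd : M = V * (diagonal fun i => (hM.eigenvalues i : ℂ)) * Vᴴ := by
    conv_lhs => rw [hM.spectral_theorem]
    rfl
  refine ⟨V.submatrix id σ, ?_, ?_⟩
  · rw [conjTranspose_submatrix, ← submatrix_mul _ _ _ id _ Function.bijective_id, hV]
    simp
  · have : (diagonal fun i => (eigDesc hM i : ℂ)) =
        (diagonal fun i => (hM.eigenvalues i : ℂ)).submatrix σ σ := by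
      rw [submatrix_diagonal_equiv]
      simp [Function.comp_def, hσ]
    rw [this, conjTranspose_submatrix, submatrix_mul_equiv, submatrix_mul_equiv]
    simpa using hd

theorem charpoly_unitary_conj {U : Matrix (Fin n) (Fin n) ℂ} (hU : Uᴴ * U = 1)
    (D : Matrix (Fin n) (Fin n) ℂ) : (U * D * Uᴴ).charpoly = D.charpoly := by
  rw [charpoly_mul_comm, ← Matrix.mul_assoc, hU, Matrix.one_mul]

theorem eigDesc_eq_of_unitary_conj (hM : M.IsHermitian) {U : Matrix (Fin n) (Fin n) ℂ}
    (hU : Uᴴ * U = 1) {d : Fin n → ℝ} (hd : Antitone d)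
    (h : M = U * (diagonal fun i => (d i : ℂ)) * Uᴴ) : eigDesc hM = d := by
  have hroots : M.charpoly.roots.map (RCLike.re : ℂ → ℝ) = Multiset.map d Finset.univ.val := by
    rw [h, charpoly_unitary_conj hU, charpoly_diagonal, Polynomial.roots_prod]
    · simp [Function.comp_def]
    · simp [Finset.prod_ne_zero_iff, Polynomial.X_sub_C_ne_zero]
  have h1 := hM.sort_roots_charpoly_eq_eigenvalues₀
  have h2 : (M.charpoly.roots.map (RCLike.re : ℂ → ℝ)).sort (· ≥ ·) = List.ofFn d := by
    rw [hroots, Fin.univ_val_map, Multiset.coe_sort]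
    apply List.mergeSort_of_pairwise
    simp_rw [decide_eq_true_eq, ← List.sortedGE_iff_pairwise]
    exact hd.sortedGE_ofFn
  have h3 : List.ofFn (eigDesc hM) = List.ofFn d := by
    rw [← h2, h1]
    exact (List.ofFn_congr (Fintype.card_fin n) _).symm
  exact List.ofFn_injective h3

theorem eigDesc_neg (hM : M.IsHermitian) (hN : (-M).IsHermitian) (i : Fin n) :
    eigDesc hN i = - eigDesc hM i.rev := by
  obtain ⟨U, hU, h⟩ := exists_unitary_diagonalization hM
  have key : eigDesc hN = fun i : Fin n => - eigDesc hM i.rev := by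
    refine eigDesc_eq_of_unitary_conj hN (U := U.submatrix id Fin.revPerm) ?_ ?_ ?_
    · rw [conjTranspose_submatrix, ← submatrix_mul _ _ _ id _ Function.bijective_id, hU]
      simp
    · intro i j hij
      exact neg_le_neg (eigDesc_antitone hM (Fin.rev_le_rev.mpr hij))
    · have : (diagonal fun i => ((- eigDesc hM i.rev : ℝ) : ℂ)) =
          (- diagonal fun i => (eigDesc hM i : ℂ)).submatrix Fin.revPerm Fin.revPerm := by
        rw [diagonal_neg, submatrix_diagonal_equiv]
        simp [Function.comp_def]
      rw [this, conjTranspose_submatrix, submatrix_mul_equiv, submatrix_mul_equiv,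
        Matrix.mul_neg, Matrix.neg_mul, ← h]
      simp
  rw [key]

theorem eigDesc_affine (hM : M.IsHermitian) {a : ℝ} (ha : 0 ≤ a) (b : ℝ)
    (hN : ((a : ℂ) • M + (b : ℂ) • 1).IsHermitian) (i : Fin n) :
    eigDesc hN i = a * eigDesc hM i + b := by
  obtain ⟨U, hU, h⟩ := exists_unitary_diagonalization hM
  have key : eigDesc hN = fun i : Fin n => a * eigDesc hM i + b := by
    refine eigDesc_eq_of_unitary_conj hN hU ?_ ?_
    · intro i j hij
      exact add_le_add_left (mul_le_mul_of_nonneg_left (eigDesc_antitone hM hij) ha) _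
    · have : (diagonal fun i => ((a * eigDesc hM i + b : ℝ) : ℂ)) =
          (a : ℂ) • (diagonal fun i => (eigDesc hM i : ℂ)) + (b : ℂ) • 1 := by
        rw [← diagonal_one, ← diagonal_smul, ← diagonal_smul, diagonal_add]
        simp
      rw [this, Matrix.mul_add, Matrix.add_mul, Matrix.mul_smul, Matrix.smul_mul, ← h,
        Matrix.mul_smul, Matrix.smul_mul, Matrix.mul_one, mul_eq_one_comm.mp hU]
  rw [key]

theorem eigDesc_sub_smul_one (hM : M.IsHermitian) (b : ℝ)
    (hN : (M - (b : ℂ) • 1).IsHermitian) (i : Fin n) :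
    eigDesc hN i = eigDesc hM i - b := by
  have e : M - (b : ℂ) • 1 = ((1 : ℝ) : ℂ) • M + ((-b : ℝ) : ℂ) • 1 := by simp [sub_eq_add_neg]
  have hN' : (((1 : ℝ) : ℂ) • M + ((-b : ℝ) : ℂ) • 1).IsHermitian := e ▸ hN
  rw [eigDesc_congr hN hN' e, eigDesc_affine hM zero_le_one]
  ring

theorem quad_eq_sum_eigDesc (hM : M.IsHermitian) {U : Matrix (Fin n) (Fin n) ℂ}
    (h : M = U * (diagonal fun i => (eigDesc hM i : ℂ)) * Uᴴ) (v : Fin n → ℂ) :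
    quad M v = ∑ i, eigDesc hM i * Complex.normSq ((Uᴴ *ᵥ v) i) := by
  rw [← quad_diagonal, ← quad_conj, conjTranspose_conjTranspose, ← h]

theorem sum_normSq_unitary {U : Matrix (Fin n) (Fin n) ℂ} (hU : Uᴴ * U = 1) (v : Fin n → ℂ) :
    ∑ i, Complex.normSq ((U *ᵥ v) i) = quad 1 v := by
  rw [← quad_one, ← quad_conj, Matrix.mul_one, hU]

theorem sum_normSq_unitary' {U : Matrix (Fin n) (Fin n) ℂ} (hU : Uᴴ * U = 1) (v : Fin n → ℂ) :
    ∑ i, Complex.normSq ((Uᴴ *ᵥ v) i) = quad 1 v :=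
  sum_normSq_unitary (by rw [conjTranspose_conjTranspose]; exact mul_eq_one_comm.mp hU) v

theorem posSemidef_sub_smul_one (hM : M.IsHermitian) {c : ℝ} (hc : ∀ i, c ≤ eigDesc hM i) :
    (M - (c : ℂ) • 1).PosSemidef := by
  refine (hM.sub (isHermitian_real_smul_one c)).posSemidef_of_quad_nonneg fun v => ?_
  obtain ⟨U, hU, h⟩ := exists_unitary_diagonalization hM
  rw [quad_sub, quad_smul, quad_eq_sum_eigDesc hM h, ← sum_normSq_unitary' hU, Finset.mul_sum,
    sub_nonneg]
  exact Finset.sum_le_sum fun i _ => mul_le_mul_of_nonneg_right (hc i) (Complex.normSq_nonneg _)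

theorem posSemidef_smul_one_sub (hM : M.IsHermitian) {c : ℝ} (hc : ∀ i, eigDesc hM i ≤ c) :
    ((c : ℂ) • 1 - M).PosSemidef := by
  refine ((isHermitian_real_smul_one c).sub hM).posSemidef_of_quad_nonneg fun v => ?_
  obtain ⟨U, hU, h⟩ := exists_unitary_diagonalization hM
  rw [quad_sub, quad_smul, quad_eq_sum_eigDesc hM h, ← sum_normSq_unitary' hU, Finset.mul_sum,
    sub_nonneg]
  exact Finset.sum_le_sum fun i _ => mul_le_mul_of_nonneg_right (hc i) (Complex.normSq_nonneg _)

/-- **Weyl's monotonicity theorem**: the ordered eigenvalues are monotone in the Loewner order. -/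
theorem eigDesc_mono (hM : M.IsHermitian) (hN : N.IsHermitian) (h : (N - M).PosSemidef)
    (i : Fin n) : eigDesc hM i ≤ eigDesc hN i := by
  obtain ⟨U, hU, hMU⟩ := exists_unitary_diagonalization hM
  obtain ⟨V, hV, hNV⟩ := exists_unitary_diagonalization hN
  -- A vector is sought in the span of the first `i + 1` columns of `U` and in that of the columns
  -- of `V` from `i` on. These are `n - 1` linear conditions; padding coordinate `i` with zero makes
  -- them a non-surjective, hence non-injective, endomorphism.
  let T : (Fin n → ℂ) →ₗ[ℂ] (Fin n → ℂ) := LinearMap.pi fun j =>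
    if i < j then LinearMap.proj j ∘ₗ Uᴴ.mulVecLin
    else if j < i then LinearMap.proj j ∘ₗ Vᴴ.mulVecLin else 0
  have hT : ¬ Function.Injective T := by
    rw [LinearMap.injective_iff_surjective]
    intro hs
    obtain ⟨v, hv⟩ := hs (Pi.single i 1)
    have := congrFun hv i
    simp [T] at this
  obtain ⟨v, hv0, hv⟩ : ∃ v, T v = 0 ∧ v ≠ 0 := by
    by_contra! hcon
    exact hT ((injective_iff_map_eq_zero T).mpr hcon)
  have hvU : ∀ j, i < j → (Uᴴ *ᵥ v) j = 0 := fun j hj => by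
    have := congrFun hv0 j
    simpa [T, hj] using this
  have hvV : ∀ j, j < i → (Vᴴ *ᵥ v) j = 0 := fun j hj => by
    have := congrFun hv0 j
    simpa [T, hj, hj.le.not_gt] using this
  have h1 : eigDesc hM i * quad 1 v ≤ quad M v := by
    rw [quad_eq_sum_eigDesc hM hMU, ← sum_normSq_unitary' hU, Finset.mul_sum]
    refine Finset.sum_le_sum fun j _ => ?_
    rcases le_or_gt j i with hj | hj
    · exact mul_le_mul_of_nonneg_right (eigDesc_antitone hM hj) (Complex.normSq_nonneg _)
    · simp [hvU j hj]
  have h2 : quad N v ≤ eigDesc hN i * quad 1 v := by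
    rw [quad_eq_sum_eigDesc hN hNV, ← sum_normSq_unitary' hV, Finset.mul_sum]
    refine Finset.sum_le_sum fun j _ => ?_
    rcases le_or_gt i j with hj | hj
    · exact mul_le_mul_of_nonneg_right (eigDesc_antitone hN hj) (Complex.normSq_nonneg _)
    · simp [hvV j hj]
  have h3 := h.quad_nonneg v
  rw [quad_sub] at h3
  exact le_of_mul_le_mul_right (by linarith) (quad_one_pos hv)

theorem sum_eigDesc (hM : M.IsHermitian) : ∑ i, eigDesc hM i = M.trace.re := by
  obtain ⟨U, hU, h⟩ := exists_unitary_diagonalization hM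
  conv_rhs => rw [h, trace_mul_comm, ← Matrix.mul_assoc, hU, Matrix.one_mul, trace_diagonal]
  simp

end EigDesc

/-! ### Lidskii–Mirsky and compression inequalities in hinge form. -/

section Lidskii

variable {n : ℕ} {P Q D F M : Matrix (Fin n) (Fin n) ℂ}

/-- Since `P - t ≤ Q + F` and `Q ≤ Q + F`, Weyl monotonicity bounds each hinge by `λᵢ(Q + F) - λᵢ(Q)
≥ 0`, and these differences sum to the trace of `F`. The best choice of `F` is the positive part of
`P - Q - t`. -/
theorem sum_hinge_eigDesc_sub_le_trace (hP : P.IsHermitian) (hQ : Q.IsHermitian)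
    (hF : F.PosSemidef) (t : ℝ) (h : ((t : ℂ) • 1 + F - (P - Q)).PosSemidef) :
    ∑ i, max (eigDesc hP i - eigDesc hQ i - t) 0 ≤ F.trace.re := by
  have hQF : (Q + F).IsHermitian := hQ.add hF.1
  have h1 : ∀ i, eigDesc hQ i ≤ eigDesc hQF i :=
    eigDesc_mono hQ hQF (by simpa using hF)
  have hPt : (P - (t : ℂ) • 1).IsHermitian := hP.sub (isHermitian_real_smul_one t)
  have h2 : ∀ i, eigDesc hP i - t ≤ eigDesc hQF i := fun i => by
    rw [← eigDesc_sub_smul_one hP t hPt]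
    refine eigDesc_mono hPt hQF ?_ i
    convert h using 1
    abel
  calc ∑ i, max (eigDesc hP i - eigDesc hQ i - t) 0
      ≤ ∑ i, (eigDesc hQF i - eigDesc hQ i) :=
        Finset.sum_le_sum fun i _ => max_le (by linarith [h2 i]) (by linarith [h1 i])
    _ = F.trace.re := by
        rw [Finset.sum_sub_distrib, sum_eigDesc, sum_eigDesc, trace_add, Complex.add_re]
        ring

/-- A convex-trace inequality (Schur–Horn for hinge functions): the diagonal of a Hermitian matrix
in an orthonormal basis is hinge-dominated by its eigenvalues. -/
theorem sum_hinge_quad_le (hD : D.IsHermitian) {U : Matrix (Fin n) (Fin n) ℂ} (hU : Uᴴ * U = 1)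
    (t : ℝ) : ∑ i, max (quad D (U *ᵥ Pi.single i 1) - t) 0 ≤ ∑ j, max (eigDesc hD j - t) 0 := by
  obtain ⟨V, hV, hDV⟩ := exists_unitary_diagonalization hD
  -- The matrix `|W j i|²` is doubly stochastic: each diagonal entry of `D` is a convex combination
  -- of eigenvalues, and the hinge is convex.
  set W : Matrix (Fin n) (Fin n) ℂ := Vᴴ * U
  have hW : Wᴴ * W = 1 := by
    simp only [W, conjTranspose_mul, conjTranspose_conjTranspose]
    rw [Matrix.mul_assoc, ← Matrix.mul_assoc V, mul_eq_one_comm.mp hV, Matrix.one_mul, hU]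
  have hcol : ∀ i, ∑ j, Complex.normSq (W j i) = 1 := fun i => by
    have := sum_normSq_unitary hW (Pi.single i 1)
    simp only [mulVec_single_one, quad_one] at this
    rw [show ∑ j, Complex.normSq (W j i) = _ from this,
      Finset.sum_eq_single i (by simp +contextual) (by simp)]
    simp
  have hrow : ∀ j, ∑ i, Complex.normSq (W j i) = 1 := fun j => by
    have := sum_normSq_unitary' hW (Pi.single j 1)
    simp only [mulVec_single_one, quad_one] at this
    rw [Finset.sum_eq_single (M := ℝ) (f := fun i => Complex.normSq ((Pi.single j 1 : Fin n → ℂ) i))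
      j (by simp +contextual) (by simp)] at this
    simpa using this
  have hq : ∀ i, quad D (U *ᵥ Pi.single i 1) - t =
      ∑ j, (eigDesc hD j - t) * Complex.normSq (W j i) := fun i => by
    rw [quad_eq_sum_eigDesc hD hDV, mulVec_mulVec]
    simp only [sub_mul, Finset.sum_sub_distrib, ← Finset.mul_sum, hcol i, mul_one,
      mulVec_single_one]
    rfl
  calc ∑ i, max (quad D (U *ᵥ Pi.single i 1) - t) 0
      ≤ ∑ i, ∑ j, max (eigDesc hD j - t) 0 * Complex.normSq (W j i) := by
        refine Finset.sum_le_sum fun i _ => max_le ?_ ?_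
        · rw [hq i]
          exact Finset.sum_le_sum fun j _ =>
            mul_le_mul_of_nonneg_right (le_max_left _ _) (Complex.normSq_nonneg _)
        · exact Finset.sum_nonneg fun j _ =>
            mul_nonneg (le_max_right _ _) (Complex.normSq_nonneg _)
    _ = ∑ j, max (eigDesc hD j - t) 0 := by
        rw [Finset.sum_comm]
        simp [← Finset.mul_sum, hrow]

theorem posSemidef_unitary_diagonal {U : Matrix (Fin n) (Fin n) ℂ} {d : Fin n → ℝ}
    (hd : ∀ i, 0 ≤ d i) : (U * (diagonal fun i => (d i : ℂ)) * Uᴴ).PosSemidef :=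
  (PosSemidef.diagonal fun i => by simpa using hd i).mul_mul_conjTranspose_same U

theorem trace_unitary_diagonal {U : Matrix (Fin n) (Fin n) ℂ} (hU : Uᴴ * U = 1) (d : Fin n → ℝ) :
    (U * (diagonal fun i => (d i : ℂ)) * Uᴴ).trace.re = ∑ i, d i := by
  rw [trace_mul_comm, ← Matrix.mul_assoc, hU, Matrix.one_mul, trace_diagonal]
  simp

/-- A **Lidskii–Mirsky inequality** in hinge form: if `-D ≤ P - Q ≤ D`, the absolute differences of
the ordered eigenvalues of `P` and `Q` are weakly majorized by the eigenvalues of `D`. -/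
theorem sum_hinge_abs_eigDesc_sub_le (hP : P.IsHermitian) (hQ : Q.IsHermitian)
    (hD : D.IsHermitian) (h1 : (D - (P - Q)).PosSemidef) (h2 : (D - (Q - P)).PosSemidef)
    {t : ℝ} (ht : 0 ≤ t) :
    ∑ i, max (|eigDesc hP i - eigDesc hQ i| - t) 0 ≤ ∑ i, max (eigDesc hD i - t) 0 := by
  have hE : (P - Q).IsHermitian := hP.sub hQ
  obtain ⟨U, hU, hEU⟩ := exists_unitary_diagonalization hE
  set e := eigDesc hE
  have hone : U * (diagonal fun _ : Fin n => (t : ℂ)) * Uᴴ = (t : ℂ) • 1 := by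
    rw [← smul_one_eq_diagonal, Matrix.mul_smul, Matrix.mul_one, Matrix.smul_mul,
      mul_eq_one_comm.mp hU]
  have hcomb : ∀ d s : Fin n → ℝ, (∀ i, s i - t ≤ d i) →
      ((t : ℂ) • 1 + U * (diagonal fun i => (d i : ℂ)) * Uᴴ -
        U * (diagonal fun i => (s i : ℂ)) * Uᴴ).PosSemidef := fun d s hds => by
    have := posSemidef_unitary_diagonal (U := U) (d := fun i => t + d i - s i)
      fun i => by linarith [hds i]
    convert this using 1
    rw [← hone, ← Matrix.add_mul, ← Matrix.mul_add, ← Matrix.sub_mul, ← Matrix.mul_sub,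
      diagonal_add, diagonal_sub]
    simp
  -- Here `F = (E - t)₊` with `E = P - Q`; `a2` takes `(-E - t)₊` for the swapped pair. As `t ≥ 0`,
  -- the two hinges add up to the hinge of the absolute value.
  have a1 := sum_hinge_eigDesc_sub_le_trace hP hQ
    (posSemidef_unitary_diagonal (U := U) (d := fun i => max (e i - t) 0)
      fun i => le_max_right _ _) t (by
        rw [hEU]
        exact hcomb _ e fun i => le_max_left _ _)
  have a2 := sum_hinge_eigDesc_sub_le_trace hQ hP
    (posSemidef_unitary_diagonal (U := U) (d := fun i => max (- e i - t) 0)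
      fun i => le_max_right _ _) t (by
        have := hcomb (fun i => max (- e i - t) 0) (fun i => - e i) fun i => le_max_left _ _
        convert this using 1
        rw [← neg_sub P Q, hEU]
        have : (diagonal fun i => ((- e i : ℝ) : ℂ)) = - diagonal fun i => (e i : ℂ) := by
          rw [diagonal_neg]
          simp
        rw [this, Matrix.mul_neg, Matrix.neg_mul])
  rw [trace_unitary_diagonal hU] at a1 a2
  have habs : ∀ x : ℝ, max (|x| - t) 0 = max (x - t) 0 + max (- x - t) 0 := fun x => by
    rcases le_total 0 x with hx | hx
    · rw [abs_of_nonneg hx, max_eq_right (a := -x - t) (by linarith), add_zero]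
    · rw [abs_of_nonpos hx, max_eq_right (a := x - t) (by linarith), zero_add]
  have hquad : ∀ i, quad (P - Q) (U *ᵥ Pi.single i 1) = e i := fun i => by
    rw [quad_eq_sum_eigDesc hE hEU, mulVec_mulVec, hU, one_mulVec,
      Finset.sum_eq_single i (by simp +contextual) (by simp)]
    simp [e]
  calc ∑ i, max (|eigDesc hP i - eigDesc hQ i| - t) 0
      ≤ ∑ i, max (e i - t) 0 + ∑ i, max (- e i - t) 0 := by
        simp_rw [habs, Finset.sum_add_distrib, neg_sub]
        exact add_le_add a1 a2
    _ = ∑ i, max (|e i| - t) 0 := by simp_rw [habs, Finset.sum_add_distrib]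
    _ ≤ ∑ i, max (quad D (U *ᵥ Pi.single i 1) - t) 0 := by
        refine Finset.sum_le_sum fun i _ => max_le_max_right _ (sub_le_sub_right ?_ _)
        -- Evaluating `-D ≤ E ≤ D` at the `i`-th eigenvector of `E` gives `|eᵢ| ≤ quad D`.
        have b1 := h1.quad_nonneg (U *ᵥ Pi.single i 1)
        have b2 := h2.quad_nonneg (U *ᵥ Pi.single i 1)
        rw [quad_sub, hquad] at b1
        rw [← neg_sub P Q, quad_sub, quad_neg, hquad] at b2
        exact abs_le.mpr ⟨by linarith, by linarith⟩
    _ ≤ ∑ i, max (eigDesc hD i - t) 0 := sum_hinge_quad_le hD hU t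

theorem exists_eq_conjTranspose_mul_self (hM : M.PosSemidef) :
    ∃ N : Matrix (Fin n) (Fin n) ℂ, M = Nᴴ * N := by
  open scoped MatrixOrder in
  exact CStarAlgebra.nonneg_iff_eq_star_mul_self.mp hM.nonneg

theorem eigDesc_nonneg (hM : M.PosSemidef) (i : Fin n) : 0 ≤ eigDesc hM.1 i := by
  have h := eigDesc_affine hM.1 (le_refl (0 : ℝ)) 0
    (by simp [IsHermitian]) i
  have := eigDesc_mono (M := ((0 : ℝ) : ℂ) • M + ((0 : ℝ) : ℂ) • 1) (by simp [IsHermitian]) hM.1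
    (by simpa using hM) i
  rw [h] at this
  linarith

/-- Compression of a positive semidefinite matrix `M` by a contraction `C` lowers the eigenvalues,
by amounts which are weakly majorized by `u` times the eigenvalues of `1 - Cᴴ C`, when `M ≤ u`. -/
theorem eigDesc_compression {C : Matrix (Fin n) (Fin n) ℂ} (hM : M.PosSemidef)
    (hC : (1 - C * Cᴴ).PosSemidef) (hH : (Cᴴ * M * C).IsHermitian) :
    (∀ i, eigDesc hH i ≤ eigDesc hM.1 i) ∧
    ∀ {u : ℝ}, 0 ≤ u → ((u : ℂ) • 1 - M).PosSemidef → ∀ {t : ℝ}, 0 ≤ t →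
      ∑ i, max (|eigDesc hM.1 i - eigDesc hH i| - t) 0 ≤
        ∑ i, max (u * eigDesc hC.1 i - t) 0 := by
  obtain ⟨N, rfl⟩ := exists_eq_conjTranspose_mul_self hM
  obtain ⟨L, hL⟩ := exists_eq_conjTranspose_mul_self hC
  have hP : (N * Nᴴ).IsHermitian := isHermitian_mul_conjTranspose_self N
  have hQ : (N * C * (N * C)ᴴ).IsHermitian := isHermitian_mul_conjTranspose_self _
  have eP : eigDesc hM.1 = eigDesc hP := eigDesc_eq_of_charpoly_eq _ _ (charpoly_mul_comm _ _)
  have eQ : eigDesc hH = eigDesc hQ := eigDesc_eq_of_charpoly_eq _ _ (by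
    rw [charpoly_mul_comm (N * C), conjTranspose_mul]
    simp only [Matrix.mul_assoc])
  have hPQ : N * Nᴴ - N * C * (N * C)ᴴ = N * Lᴴ * (N * Lᴴ)ᴴ := by
    have : N * (1 - C * Cᴴ) * Nᴴ = N * (Lᴴ * L) * Nᴴ := by rw [hL]
    simp only [conjTranspose_mul, conjTranspose_conjTranspose, Matrix.mul_sub, Matrix.sub_mul,
      Matrix.mul_one, Matrix.mul_assoc] at this ⊢
    exact this
  have hE : (N * Nᴴ - N * C * (N * C)ᴴ).PosSemidef := by
    rw [hPQ]
    exact posSemidef_self_mul_conjTranspose _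
  rw [eP, eQ]
  refine ⟨eigDesc_mono hQ hP hE, fun {u} hu hMu {t} ht => ?_⟩
  -- With `D = P - Q ≥ 0` the two Loewner hypotheses become `0 ≥ 0` and `2 D ≥ 0`.
  refine (sum_hinge_abs_eigDesc_sub_le hP hQ hE.1 (by simpa using PosSemidef.zero) ?_ ht).trans ?_
  · rw [← neg_sub (N * Nᴴ), sub_neg_eq_add]
    exact hE.add hE
  refine Finset.sum_le_sum fun i _ => max_le_max_right _ (sub_le_sub_right ?_ _)
  -- With `1 - C Cᴴ = Lᴴ L`, the difference `N Lᴴ L Nᴴ` has the spectrum of `L (Nᴴ N) Lᴴ ≤ u L Lᴴ`,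
  -- and `L Lᴴ` has the spectrum of `1 - C Cᴴ`.
  have hS : (L * (Nᴴ * N) * Lᴴ).IsHermitian := isHermitian_mul_mul_conjTranspose L hM.1
  have eS : eigDesc hE.1 = eigDesc hS := eigDesc_eq_of_charpoly_eq _ _ (by
    rw [hPQ, charpoly_mul_comm]
    simp only [conjTranspose_mul, conjTranspose_conjTranspose, Matrix.mul_assoc])
  have hLL : (L * Lᴴ).IsHermitian := isHermitian_mul_conjTranspose_self L
  have eL : eigDesc hC.1 = eigDesc hLL := eigDesc_eq_of_charpoly_eq _ _ (by
    rw [hL, charpoly_mul_comm])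
  have huL : ((u : ℂ) • (L * Lᴴ) + ((0 : ℝ) : ℂ) • 1).IsHermitian :=
    (hLL.real_smul u).add (isHermitian_real_smul_one 0)
  have := eigDesc_mono hS huL (by
    have := hMu.mul_mul_conjTranspose_same L
    simpa [Matrix.mul_sub, Matrix.sub_mul] using this) i
  rw [eigDesc_affine hLL hu, add_zero] at this
  rwa [eS, eL]

end Lidskii

/-! ### Ritz value bounds for an invariant column space. -/

section RitzBounds

variable {n k : ℕ} {A : Matrix (Fin n) (Fin n) ℂ} {X Y : Matrix (Fin n) (Fin k) ℂ}

theorem eigDesc_one_sub {M : Matrix (Fin k) (Fin k) ℂ} (hM : M.IsHermitian)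
    (hN : (1 - M).IsHermitian) (i : Fin k) : eigDesc hN i = 1 - eigDesc hM i.rev := by
  have e : 1 - M = ((1 : ℝ) : ℂ) • (-M) + ((1 : ℝ) : ℂ) • 1 := by simp [sub_eq_neg_add]
  rw [eigDesc_congr hN (e ▸ hN) e, eigDesc_affine hM.neg zero_le_one, eigDesc_neg hM]
  ring

/-- Compression produces `1 - C Cᴴ`, while the residual produces `1 - Cᴴ C`; this lets the two be
compared. -/
theorem eigDesc_one_sub_mul_conjTranspose {C : Matrix (Fin k) (Fin k) ℂ}
    (h1 : (1 - C * Cᴴ).IsHermitian) (h2 : (1 - Cᴴ * C).IsHermitian) :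
    eigDesc h1 = eigDesc h2 := by
  funext i
  rw [eigDesc_one_sub (isHermitian_mul_conjTranspose_self C),
    eigDesc_one_sub (isHermitian_conjTranspose_mul_self C),
    eigDesc_eq_of_charpoly_eq _ (isHermitian_conjTranspose_mul_self C) (charpoly_mul_comm _ _)]

/-- The residual `(1 - X Xᴴ) Y` of `Y` with respect to the column space of `X`. -/
def projResidual (X Y : Matrix (Fin n) (Fin k) ℂ) : Matrix (Fin n) (Fin k) ℂ :=
  Y - X * (Xᴴ * Y)

theorem conjTranspose_mul_projResidual (hX : Xᴴ * X = 1) : Xᴴ * projResidual X Y = 0 := by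
  rw [projResidual, Matrix.mul_sub, ← Matrix.mul_assoc, hX, Matrix.one_mul, sub_self]

theorem projResidual_conjTranspose_mul_self (hX : Xᴴ * X = 1) (hY : Yᴴ * Y = 1) :
    (projResidual X Y)ᴴ * projResidual X Y = 1 - (Xᴴ * Y)ᴴ * (Xᴴ * Y) := by
  conv_lhs =>
    enter [1]
    rw [projResidual]
  rw [conjTranspose_sub, Matrix.sub_mul, conjTranspose_mul X, Matrix.mul_assoc _ Xᴴ,
    conjTranspose_mul_projResidual hX, Matrix.mul_zero, sub_zero, projResidual, Matrix.mul_sub, hY]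
  simp only [conjTranspose_mul, conjTranspose_conjTranspose, Matrix.mul_assoc]

theorem posSemidef_one_sub_conjTranspose_mul (hX : Xᴴ * X = 1) (hY : Yᴴ * Y = 1) :
    (1 - (Xᴴ * Y)ᴴ * (Xᴴ * Y)).PosSemidef := by
  rw [← projResidual_conjTranspose_mul_self hX hY]
  exact posSemidef_conjTranspose_mul_self _

theorem posSemidef_one_sub_mul_conjTranspose (hX : Xᴴ * X = 1) (hY : Yᴴ * Y = 1) :
    (1 - (Xᴴ * Y) * (Xᴴ * Y)ᴴ).PosSemidef := by
  simpa [conjTranspose_mul] using posSemidef_one_sub_conjTranspose_mul hY hX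

/-- Block decomposition of a compression of a matrix which leaves the column space of `X`
invariant. -/
theorem compression_eq_add (hA : A.IsHermitian) (hX : Xᴴ * X = 1)
    (hinv : A * X = X * (Xᴴ * A * X)) :
    Yᴴ * A * Y = (Xᴴ * Y)ᴴ * (Xᴴ * A * X) * (Xᴴ * Y) +
      (projResidual X Y)ᴴ * A * projResidual X Y := by
  set R := projResidual X Y with hR
  set C := Xᴴ * Y with hC
  have hY : Y = X * C + R := by simp [hR, projResidual, hC]
  have h1 : Xᴴ * A * R = 0 := by
    have : Xᴴ * A = (Xᴴ * A * X) * Xᴴ := by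
      have := congrArg conjTranspose hinv
      simpa [conjTranspose_mul, hA.eq, Matrix.mul_assoc] using this
    rw [this, Matrix.mul_assoc, conjTranspose_mul_projResidual hX, Matrix.mul_zero]
  have h2 : Rᴴ * A * X = 0 := by
    have := congrArg conjTranspose h1
    simpa [conjTranspose_mul, hA.eq, Matrix.mul_assoc] using this
  calc Yᴴ * A * Y = (X * C + R)ᴴ * A * (X * C + R) := by rw [← hY]
    _ = Cᴴ * (Xᴴ * A * X) * C + Cᴴ * (Xᴴ * A * R) + Rᴴ * A * X * C + Rᴴ * A * R := by
      simp only [conjTranspose_add, conjTranspose_mul, Matrix.add_mul, Matrix.mul_add,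
        Matrix.mul_assoc]
      abel
    _ = _ := by rw [h1, h2]; simp

theorem compression_sub_smul_one (hX : Xᴴ * X = 1) (s : ℝ) :
    Xᴴ * (A - (s : ℂ) • 1) * X = Xᴴ * A * X - (s : ℂ) • 1 := by
  rw [Matrix.mul_sub, Matrix.sub_mul, Matrix.mul_smul, Matrix.smul_mul, Matrix.mul_one, hX]

theorem compression_neg : Xᴴ * (-A) * X = -(Xᴴ * A * X) := by
  rw [Matrix.mul_neg, Matrix.neg_mul]

theorem ritzValues_sub_smul_one (hA : A.IsHermitian) (hX : Xᴴ * X = 1) (s : ℝ)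
    (hA' : (A - (s : ℂ) • 1).IsHermitian) (i : Fin k) :
    ritzValues hA' X i = ritzValues hA X i - s := by
  have hH : (Xᴴ * A * X - (s : ℂ) • 1).IsHermitian :=
    (isHermitian_conjTranspose_mul_mul X hA).sub (isHermitian_real_smul_one s)
  rw [ritzValues, eigDesc_congr _ hH (compression_sub_smul_one hX s), eigDesc_sub_smul_one]
  rfl

theorem ritzValues_neg (hA : A.IsHermitian) (hA' : (-A).IsHermitian) (i : Fin k) :
    ritzValues hA' X i = - ritzValues hA X i.rev := by
  rw [ritzValues, eigDesc_congr _ (isHermitian_conjTranspose_mul_mul X hA).neg compression_neg,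
    eigDesc_neg]
  rfl

theorem invariant_sub_smul_one (hX : Xᴴ * X = 1) (hinv : A * X = X * (Xᴴ * A * X)) (s : ℝ) :
    (A - (s : ℂ) • 1) * X = X * (Xᴴ * (A - (s : ℂ) • 1) * X) := by
  rw [compression_sub_smul_one hX, Matrix.sub_mul, hinv, Matrix.mul_sub]
  simp

theorem invariant_neg (hinv : A * X = X * (Xᴴ * A * X)) : -A * X = X * (Xᴴ * (-A) * X) := by
  rw [compression_neg, Matrix.neg_mul, hinv, Matrix.mul_neg]

theorem sum_hinge_ritzValues_neg (hA : A.IsHermitian) (hA' : (-A).IsHermitian) (t : ℝ) :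
    ∑ i, max (|ritzValues hA' X i - ritzValues hA' Y i| - t) 0 =
      ∑ i, max (|ritzValues hA X i - ritzValues hA Y i| - t) 0 := by
  rw [← Equiv.sum_comp Fin.revPerm]
  refine Finset.sum_congr rfl fun i _ => ?_
  rw [ritzValues_neg hA, ritzValues_neg hA, ← abs_neg]
  simp [sub_eq_neg_add, add_comm]

/-- Ritz value bound for the invariant column space of `X`, when the positive semidefinite matrix
`A ≤ u` is separated by the value `c` on the column space of `X` and its orthogonal complement. -/
theorem sum_hinge_ritzValues_of_separated_of_posSemidef (hA : A.PosSemidef)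
    (hX : Xᴴ * X = 1) (hY : Yᴴ * Y = 1) (hinv : A * X = X * (Xᴴ * A * X)) {u c : ℝ}
    (hu : 0 ≤ u) (hAu : ((u : ℂ) • 1 - A).PosSemidef)
    (hc : (Xᴴ * A * X - (c : ℂ) • 1).PosSemidef)
    (hc' : ∀ v, Xᴴ *ᵥ v = 0 → quad A v ≤ c * quad 1 v) {t : ℝ} (ht : 0 ≤ t) :
    ∑ i, max (|ritzValues hA.1 X i - ritzValues hA.1 Y i| - t) 0 ≤
      ∑ i, max (u * eigDesc (posSemidef_one_sub_mul_conjTranspose hX hY).1 i - t) 0 := by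
  have hK := posSemidef_one_sub_mul_conjTranspose hX hY
  have hM : (Xᴴ * A * X).PosSemidef := hA.conjTranspose_mul_mul_same X
  have hH : ((Xᴴ * Y)ᴴ * (Xᴴ * A * X) * (Xᴴ * Y)).IsHermitian :=
    isHermitian_conjTranspose_mul_mul _ hM.1
  have hB : (Yᴴ * A * Y).IsHermitian := isHermitian_conjTranspose_mul_mul Y hA.1
  obtain ⟨-, hcomp⟩ := eigDesc_compression hM hK hH
  have hMu : ((u : ℂ) • 1 - Xᴴ * A * X).PosSemidef := by
    have := hAu.conjTranspose_mul_mul_same X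
    simpa [Matrix.mul_sub, Matrix.sub_mul, hX] using this
  refine le_trans (Finset.sum_le_sum fun i _ => max_le_max_right _ (sub_le_sub_right ?_ _))
    (hcomp hu hMu ht)
  have hlow : eigDesc hH i ≤ eigDesc hB i := eigDesc_mono hH hB (by
    rw [compression_eq_add hA.1 hX hinv, add_sub_cancel_left]
    exact hA.conjTranspose_mul_mul_same _) i
  -- Since `A ≤ c` on the range of the residual, `Yᴴ A Y - c ≤ Cᴴ (M - c) C` with `C = Xᴴ Y` and `M
  -- = Xᴴ A X`; as `M - c ≥ 0`, the contraction `C` can only lower its eigenvalues.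
  have hup : eigDesc hB i ≤ eigDesc hM.1 i := by
    have hHc : ((Xᴴ * Y)ᴴ * (Xᴴ * A * X - (c : ℂ) • 1) * (Xᴴ * Y)).IsHermitian :=
      isHermitian_conjTranspose_mul_mul _ hc.1
    have hBc : (Yᴴ * A * Y - (c : ℂ) • 1).IsHermitian := hB.sub (isHermitian_real_smul_one c)
    have h1 := (eigDesc_compression hc hK hHc).1 i
    have h2 : eigDesc hBc i ≤ eigDesc hHc i := eigDesc_mono hBc hHc (by
      refine (hHc.sub hBc).posSemidef_of_quad_nonneg fun v => ?_
      have h3 := hc' (projResidual X Y *ᵥ v) (by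
        rw [mulVec_mulVec, conjTranspose_mul_projResidual hX, zero_mulVec])
      have h4 : quad 1 (projResidual X Y *ᵥ v) = quad 1 v - quad 1 ((Xᴴ * Y) *ᵥ v) := by
        rw [← quad_conj, Matrix.mul_one, projResidual_conjTranspose_mul_self hX hY, quad_sub,
          ← quad_conj 1 (Xᴴ * Y), Matrix.mul_one]
      rw [h4, mul_sub] at h3
      rw [compression_eq_add (Y := Y) hA.1 hX hinv]
      simp only [quad_sub, quad_add, quad_conj, quad_smul] at h3 ⊢
      linarith) i
    rw [eigDesc_sub_smul_one hM.1] at h1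
    rw [eigDesc_sub_smul_one hB] at h2
    linarith
  change |eigDesc hM.1 i - eigDesc hB i| ≤ _
  rw [abs_of_nonneg (by linarith), abs_of_nonneg (by linarith)]
  linarith

theorem sum_hinge_ritzValues_of_separated (hA : A.IsHermitian)
    (hX : Xᴴ * X = 1) (hY : Yᴴ * Y = 1) (hinv : A * X = X * (Xᴴ * A * X)) {l u c : ℝ}
    (hlu : l ≤ u) (hAl : (A - (l : ℂ) • 1).PosSemidef) (hAu : ((u : ℂ) • 1 - A).PosSemidef)
    (hc : (Xᴴ * A * X - (c : ℂ) • 1).PosSemidef)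
    (hc' : ∀ v, Xᴴ *ᵥ v = 0 → quad A v ≤ c * quad 1 v) {t : ℝ} (ht : 0 ≤ t) :
    ∑ i, max (|ritzValues hA X i - ritzValues hA Y i| - t) 0 ≤
      ∑ i, max ((u - l) * eigDesc (posSemidef_one_sub_mul_conjTranspose hX hY).1 i - t) 0 := by
  have := sum_hinge_ritzValues_of_separated_of_posSemidef (c := c - l) hAl hX hY
    (invariant_sub_smul_one hX hinv l) (sub_nonneg.mpr hlu)
    (by convert hAu using 1; push_cast; rw [sub_smul]; abel)
    (by
      rw [compression_sub_smul_one hX]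
      convert hc using 1; push_cast; rw [sub_smul]; abel)
    (fun v hv => by
      rw [quad_sub, quad_smul]
      linarith [hc' v hv]) ht
  simpa only [ritzValues_sub_smul_one hA hX, ritzValues_sub_smul_one hA hY,
    sub_sub_sub_cancel_right] using this

/-- Ritz value bound for the invariant column space of `X`, when `-h ≤ A ≤ h` and `A` is
nonnegative on the column space of `X`. -/
theorem sum_hinge_ritzValues_of_nonneg_on (hA : A.IsHermitian)
    (hX : Xᴴ * X = 1) (hY : Yᴴ * Y = 1) (hinv : A * X = X * (Xᴴ * A * X)) {h : ℝ}
    (hh : 0 ≤ h) (hAl : ((h : ℂ) • 1 + A).PosSemidef) (hAu : ((h : ℂ) • 1 - A).PosSemidef)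
    (hM : (Xᴴ * A * X).PosSemidef) {t : ℝ} (ht : 0 ≤ t) :
    ∑ i, max (|ritzValues hA X i - ritzValues hA Y i| - t) 0 ≤
      ∑ i, max (2 * h * eigDesc (posSemidef_one_sub_mul_conjTranspose hX hY).1 i - t) 0 := by
  have hK := posSemidef_one_sub_mul_conjTranspose hX hY
  have hK' := posSemidef_one_sub_conjTranspose_mul hX hY
  have hH : ((Xᴴ * Y)ᴴ * (Xᴴ * A * X) * (Xᴴ * Y)).IsHermitian :=
    isHermitian_conjTranspose_mul_mul _ hM.1
  have hB : (Yᴴ * A * Y).IsHermitian := isHermitian_conjTranspose_mul_mul Y hA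
  have hMu : ((h : ℂ) • 1 - Xᴴ * A * X).PosSemidef := by
    have := hAu.conjTranspose_mul_mul_same X
    simpa [Matrix.mul_sub, Matrix.sub_mul, hX] using this
  -- Two errors of equal size will be added, so the threshold is split evenly: `(a + b - t)₊ ≤ (a -
  -- t/2)₊ + (b - t/2)₊`.
  have ht2 : 0 ≤ t / 2 := by linarith
  have b1 := (eigDesc_compression hM hK hH).2 hh hMu ht2
  set R := projResidual X Y
  have hRR : Rᴴ * R = 1 - (Xᴴ * Y)ᴴ * (Xᴴ * Y) := projResidual_conjTranspose_mul_self hX hY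
  have hD : ((h : ℂ) • (1 - (Xᴴ * Y)ᴴ * (Xᴴ * Y)) + ((0 : ℝ) : ℂ) • 1).IsHermitian :=
    (hK'.1.real_smul h).add (isHermitian_real_smul_one 0)
  have hdec : Yᴴ * A * Y - (Xᴴ * Y)ᴴ * (Xᴴ * A * X) * (Xᴴ * Y) = Rᴴ * A * R := by
    rw [compression_eq_add hA hX hinv, add_sub_cancel_left]
  have b2 := sum_hinge_abs_eigDesc_sub_le hH hB hD
    (by
      rw [← neg_sub (Yᴴ * A * Y), hdec, ← hRR]
      have := hAl.conjTranspose_mul_mul_same R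
      simpa [Matrix.mul_add, Matrix.add_mul] using this)
    (by
      rw [hdec, ← hRR]
      have := hAu.conjTranspose_mul_mul_same R
      simpa [Matrix.mul_sub, Matrix.sub_mul] using this) ht2
  simp only [eigDesc_affine hK'.1 hh, add_zero,
    ← eigDesc_one_sub_mul_conjTranspose hK.1 hK'.1] at b2
  calc ∑ i, max (|ritzValues hA X i - ritzValues hA Y i| - t) 0
      ≤ ∑ i, (max (|eigDesc hM.1 i - eigDesc hH i| - t / 2) 0 +
          max (|eigDesc hH i - eigDesc hB i| - t / 2) 0) := by
        refine Finset.sum_le_sum fun i _ => max_le ?_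
          (add_nonneg (le_max_right _ _) (le_max_right _ _))
        have h1 := abs_sub_le (eigDesc hM.1 i) (eigDesc hH i) (eigDesc hB i)
        have h2 := le_max_left (|eigDesc hM.1 i - eigDesc hH i| - t / 2) 0
        have h3 := le_max_left (|eigDesc hH i - eigDesc hB i| - t / 2) 0
        change |eigDesc hM.1 i - eigDesc hB i| - t ≤ _
        linarith
    _ ≤ ∑ i, (max (h * eigDesc hK.1 i - t / 2) 0 + max (h * eigDesc hK.1 i - t / 2) 0) := by
        rw [Finset.sum_add_distrib, Finset.sum_add_distrib]
        exact add_le_add b1 b2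
    _ = _ := by
        refine Finset.sum_congr rfl fun i _ => ?_
        rw [← two_mul, mul_max_of_nonneg _ _ zero_le_two, mul_zero]
        ring_nf

theorem sum_hinge_ritzValues_of_half (hA : A.IsHermitian)
    (hX : Xᴴ * X = 1) (hY : Yᴴ * Y = 1) (hinv : A * X = X * (Xᴴ * A * X)) {l u : ℝ}
    (hlu : l ≤ u) (hAl : (A - (l : ℂ) • 1).PosSemidef) (hAu : ((u : ℂ) • 1 - A).PosSemidef)
    (hM : (Xᴴ * A * X - (((u + l) / 2 : ℝ) : ℂ) • 1).PosSemidef) {t : ℝ} (ht : 0 ≤ t) :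
    ∑ i, max (|ritzValues hA X i - ritzValues hA Y i| - t) 0 ≤
      ∑ i, max ((u - l) * eigDesc (posSemidef_one_sub_mul_conjTranspose hX hY).1 i - t) 0 := by
  have e1 : (((u - l) / 2 : ℝ) : ℂ) • (1 : Matrix (Fin n) (Fin n) ℂ) +
      (A - (((u + l) / 2 : ℝ) : ℂ) • 1) = A - (l : ℂ) • 1 := by
    push_cast
    module
  have e2 : (((u - l) / 2 : ℝ) : ℂ) • (1 : Matrix (Fin n) (Fin n) ℂ) -
      (A - (((u + l) / 2 : ℝ) : ℂ) • 1) = (u : ℂ) • 1 - A := by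
    push_cast
    module
  have hA' := hA.sub (isHermitian_real_smul_one ((u + l) / 2))
  have := sum_hinge_ritzValues_of_nonneg_on hA' hX hY (invariant_sub_smul_one hX hinv _)
    (h := (u - l) / 2) (by linarith) (by rwa [e1]) (by rwa [e2])
    (by rwa [compression_sub_smul_one hX]) ht
  simpa only [ritzValues_sub_smul_one hA hX, ritzValues_sub_smul_one hA hY, sub_sub_sub_cancel_right,
    mul_div_cancel₀ (u - l) (two_ne_zero' ℝ)] using this

end RitzBounds

/-! ### From hinge inequalities to weak majorization. -/

section Majorization

variable {m : ℕ} {x y : Fin m → ℝ}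

theorem descending_antitone (x : Fin m → ℝ) : Antitone (descending x) :=
  fun _ _ hij => Tuple.monotone_sort x (Fin.rev_le_rev.mpr hij)

theorem sum_comp_descending (x : Fin m → ℝ) (f : ℝ → ℝ) :
    ∑ i, f (descending x i) = ∑ i, f (x i) :=
  Equiv.sum_comp (Fin.revPerm.trans (Tuple.sort x)) fun i => f (x i)

theorem weakMajorized_of_sum_hinge_le (hy : ∀ i, 0 ≤ y i)
    (h : ∀ t, 0 ≤ t → ∑ i, max (x i - t) 0 ≤ ∑ i, max (y i - t) 0) : WeakMajorized x y := by
  intro j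
  -- At this threshold the hinge sum of `y` is exactly its partial sum up to `j` minus `t` per term,
  -- while for `x` the same expression is at most the hinge sum.
  set t := descending y j with ht
  have h1 : ∑ i ∈ Finset.Iic j, descending x i ≤
      ∑ i ∈ Finset.Iic j, (t + max (descending x i - t) 0) :=
    Finset.sum_le_sum fun i _ => by linarith [le_max_left (descending x i - t) 0]
  have h2 : ∑ i ∈ Finset.Iic j, max (descending x i - t) 0 ≤ ∑ i, max (descending x i - t) 0 :=
    Finset.sum_le_sum_of_subset_of_nonneg (Finset.subset_univ _) fun i _ _ => le_max_right _ _
  have h3 : ∑ i, max (descending y i - t) 0 = ∑ i ∈ Finset.Iic j, (descending y i - t) := by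
    rw [← Finset.sum_subset (Finset.subset_univ (Finset.Iic j))]
    · refine Finset.sum_congr rfl fun i hi => max_eq_left (sub_nonneg.mpr ?_)
      exact descending_antitone y (Finset.mem_Iic.mp hi)
    · intro i _ hi
      refine max_eq_right (sub_nonpos.mpr (descending_antitone y ?_))
      exact (not_le.mp fun hle => hi (Finset.mem_Iic.mpr hle)).le
  have h4 := h t (hy _)
  rw [← sum_comp_descending x fun z => max (z - t) 0,
    ← sum_comp_descending y fun z => max (z - t) 0, h3] at h4
  rw [Finset.sum_add_distrib] at h1
  rw [Finset.sum_sub_distrib] at h4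
  linarith

end Majorization

/-! ### Translation from subspaces, eigenvectors and principal angles to matrices. -/

section Subspaces

variable {n k : ℕ} {A : Matrix (Fin n) (Fin n) ℂ} {X Y : Matrix (Fin n) (Fin k) ℂ}
  {𝒳 : Submodule ℂ (EuclideanSpace ℂ (Fin n))}

theorem IsOrthonormalBasisMatrix.conjTranspose_mul_self (hX : IsOrthonormalBasisMatrix X 𝒳) :
    Xᴴ * X = 1 := by
  ext i j
  have := orthonormal_iff_ite.mp hX.1 i j
  rw [EuclideanSpace.inner_eq_star_dotProduct] at this
  rw [one_apply, ← this, mul_apply, dotProduct_comm]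
  rfl

theorem IsOrthonormalBasisMatrix.mem_iff (hX : IsOrthonormalBasisMatrix X 𝒳)
    (v : EuclideanSpace ℂ (Fin n)) : v ∈ 𝒳 ↔ ∃ w, v.ofLp = X *ᵥ w := by
  rw [← hX.2, Submodule.mem_span_range_iff_exists_fun]
  refine exists_congr fun w => ?_
  have : X *ᵥ w = (∑ j, w j • (WithLp.toLp 2 (X.col j) : EuclideanSpace ℂ (Fin n))).ofLp := by
    ext i
    simp [mulVec, dotProduct, mul_comm]
  rw [this]
  exact ⟨fun h => h ▸ rfl, fun h => (WithLp.ofLp_injective 2 h).symm⟩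

theorem IsOrthonormalBasisMatrix.mul_eq_of_invariant (hX : IsOrthonormalBasisMatrix X 𝒳)
    (hinv : IsInvariantSubspace A 𝒳) : A * X = X * (Xᴴ * A * X) := by
  have h1 : ∀ j, ∃ w, A *ᵥ X.col j = X *ᵥ w := fun j => by
    refine (hX.mem_iff (WithLp.toLp 2 (A *ᵥ X.col j))).mp ?_
    refine hinv (WithLp.toLp 2 (X.col j)) ((hX.mem_iff _).mpr ⟨Pi.single j 1, ?_⟩)
    rw [mulVec_single_one]
  choose w hw using h1
  have h2 : A * X = X * (of w)ᵀ := by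
    ext i j
    exact congrFun (hw j) i
  rw [Matrix.mul_assoc, h2, ← Matrix.mul_assoc Xᴴ, hX.conjTranspose_mul_self, Matrix.one_mul]

theorem spr_nonneg [NeZero n] (hA : A.IsHermitian) : 0 ≤ spr hA :=
  sub_nonneg.mpr (eigDesc_antitone hA (Fin.zero_le _))

theorem posSemidef_sub_eigMin [NeZero n] (hA : A.IsHermitian) :
    (A - (eigMin hA : ℂ) • 1).PosSemidef :=
  posSemidef_sub_smul_one hA fun i => eigDesc_antitone hA (by
    rw [Fin.le_rev_iff]
    exact Fin.zero_le _)

theorem posSemidef_eigMax_sub [NeZero n] (hA : A.IsHermitian) :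
    ((eigMax hA : ℂ) • 1 - A).PosSemidef :=
  posSemidef_smul_one_sub hA fun _ => eigDesc_antitone hA (Fin.zero_le _)

/-- Separation of the Rayleigh quotients of `A` by `c` on a span of eigenvectors and on its
orthogonal complement. -/
theorem separated_of_eigenbasis (hA : A.IsHermitian) (hX : IsOrthonormalBasisMatrix X 𝒳)
    {u : OrthonormalBasis (Fin n) ℂ (EuclideanSpace ℂ (Fin n))} {d : Fin n → ℝ}
    (hu : ∀ i, toEuclideanLin A (u i) = (d i : ℂ) • u i) {S : Set (Fin n)}
    (hS : 𝒳 = Submodule.span ℂ (u '' S)) {c : ℝ} (h1 : ∀ i ∈ S, c ≤ d i)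
    (h2 : ∀ i ∉ S, d i ≤ c) :
    (Xᴴ * A * X - (c : ℂ) • 1).PosSemidef ∧
      ∀ v, Xᴴ *ᵥ v = 0 → quad A v ≤ c * quad 1 v := by
  let U : Matrix (Fin n) (Fin n) ℂ := of fun a i => u i a
  have hU : Uᴴ * U = 1 := by
    ext i j
    have := orthonormal_iff_ite.mp u.orthonormal i j
    rw [EuclideanSpace.inner_eq_star_dotProduct] at this
    rw [one_apply, ← this, mul_apply, dotProduct_comm]
    rfl
  have hUv : ∀ v i, (Uᴴ *ᵥ v) i = inner ℂ (u i) (WithLp.toLp 2 v) := fun v i => by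
    rw [EuclideanSpace.inner_eq_star_dotProduct, dotProduct_comm]
    rfl
  have hAU : A = U * (diagonal fun i => (d i : ℂ)) * Uᴴ := by
    have : A * U = U * diagonal fun i => (d i : ℂ) := by
      ext a i
      rw [mul_diagonal, mul_comm]
      exact congrFun (congrArg WithLp.ofLp (hu i)) a
    rw [← this, Matrix.mul_assoc, mul_eq_one_comm.mp hU, Matrix.mul_one]
  have hquad : ∀ v, quad A v = ∑ i, d i * Complex.normSq ((Uᴴ *ᵥ v) i) := fun v => by
    rw [← quad_diagonal, ← quad_conj, conjTranspose_conjTranspose, ← hAU]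
  constructor
  · refine ((isHermitian_conjTranspose_mul_mul X hA).sub
      (isHermitian_real_smul_one c)).posSemidef_of_quad_nonneg fun w => ?_
    have hmem : (WithLp.toLp 2 (X *ᵥ w) : EuclideanSpace ℂ (Fin n)) ∈ 𝒳 :=
      (hX.mem_iff _).mpr ⟨w, rfl⟩
    -- Vectors of `𝒳` have no components along the eigenvectors outside `S`; in the second half,
    -- vectors orthogonal to `𝒳` have none along those in `S`.
    have hzero : ∀ i ∉ S, (Uᴴ *ᵥ (X *ᵥ w)) i = 0 := fun i hi => by
      rw [hUv]
      rw [hS] at hmem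
      have hle : Submodule.span ℂ (u '' S) ≤ LinearMap.ker (innerSL ℂ (u i)).toLinearMap := by
        rw [Submodule.span_le]
        rintro _ ⟨j, hj, rfl⟩
        have hij : i ≠ j := fun h => hi (h ▸ hj)
        simpa using u.orthonormal.2 hij
      simpa using hle hmem
    have hq1 : quad 1 w = ∑ i, Complex.normSq ((Uᴴ *ᵥ (X *ᵥ w)) i) := by
      rw [sum_normSq_unitary' hU, ← quad_conj, Matrix.mul_one, hX.conjTranspose_mul_self]
    rw [quad_sub, quad_conj, quad_smul, hq1, hquad, Finset.mul_sum, sub_nonneg]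
    refine Finset.sum_le_sum fun i _ => ?_
    by_cases hi : i ∈ S
    · exact mul_le_mul_of_nonneg_right (h1 i hi) (Complex.normSq_nonneg _)
    · simp [hzero i hi]
  · intro v hv
    rw [hquad, ← sum_normSq_unitary' hU, Finset.mul_sum]
    refine Finset.sum_le_sum fun i _ => ?_
    by_cases hi : i ∈ S
    · have hmem : u i ∈ 𝒳 := hS ▸ Submodule.subset_span ⟨i, hi, rfl⟩
      obtain ⟨w, hw⟩ := (hX.mem_iff _).mp hmem
      have : (Uᴴ *ᵥ v) i = 0 := by
        rw [hUv, EuclideanSpace.inner_eq_star_dotProduct, hw, dotProduct_comm, star_mulVec,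
          ← dotProduct_mulVec, hv, dotProduct_zero]
      simp [this]
    · exact mul_le_mul_of_nonneg_right (h2 i hi) (Complex.normSq_nonneg _)

/-- Invariance makes `X` carry an eigenvector of `Xᴴ A X` to one of `A`. Thus the half-spectrum
condition on eigenvectors becomes a Loewner bound on `Xᴴ A X`. -/
theorem isEigenvalueOn_ritzValues (hA : A.IsHermitian) (hX : IsOrthonormalBasisMatrix X 𝒳)
    (hinv : A * X = X * (Xᴴ * A * X)) (i : Fin k) :
    IsEigenvalueOn A 𝒳 (ritzValues hA X i) := by
  obtain ⟨U, hU, h⟩ := exists_unitary_diagonalization (isHermitian_conjTranspose_mul_mul X hA)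
  have hw : (Xᴴ * A * X) *ᵥ (U *ᵥ Pi.single i 1) =
      (ritzValues hA X i : ℂ) • (U *ᵥ Pi.single i 1) := by
    conv_lhs => rw [h]
    rw [mulVec_mulVec, Matrix.mul_assoc, hU, Matrix.mul_one, ← mulVec_mulVec,
      diagonal_mulVec_single, mul_one, ← mulVec_smul]
    congr 1
    ext j
    simp [Pi.single_apply, ritzValues]
  refine ⟨WithLp.toLp 2 (X *ᵥ (U *ᵥ Pi.single i 1)), (hX.mem_iff _).mpr ⟨_, rfl⟩, ?_, ?_⟩
  · intro h0
    have h1 : X *ᵥ (U *ᵥ Pi.single i 1) = 0 := congrArg WithLp.ofLp h0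
    have h2 := congrArg (fun z => Uᴴ *ᵥ (Xᴴ *ᵥ z)) h1
    simp only [mulVec_mulVec, mulVec_zero] at h2
    rw [← Matrix.mul_assoc Xᴴ, hX.conjTranspose_mul_self, Matrix.one_mul, hU, one_mulVec] at h2
    simpa using congrFun h2 i
  · refine WithLp.ofLp_injective 2 ?_
    change A *ᵥ (X *ᵥ (U *ᵥ Pi.single i 1)) = (ritzValues hA X i : ℂ) • (X *ᵥ (U *ᵥ Pi.single i 1))
    rw [mulVec_mulVec, hinv, ← mulVec_mulVec, hw, mulVec_smul]

theorem sum_hinge_ritzValues_of_invariant [NeZero n] (hA : A.IsHermitian)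
    (hX : IsOrthonormalBasisMatrix X 𝒳) (hY : Yᴴ * Y = 1) (hinv : IsInvariantSubspace A 𝒳)
    (h : (CorrespondsToLargest hA 𝒳 ∨ CorrespondsToSmallest hA 𝒳) ∨ InHalfSpectrum hA 𝒳)
    {t : ℝ} (ht : 0 ≤ t) :
    ∑ i, max (|ritzValues hA X i - ritzValues hA Y i| - t) 0 ≤
      ∑ i, max (spr hA * eigDesc
        (posSemidef_one_sub_mul_conjTranspose hX.conjTranspose_mul_self hY).1 i - t) 0 := by
  have hXX := hX.conjTranspose_mul_self
  have hAX := hX.mul_eq_of_invariant hinv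
  have hlu : eigMin hA ≤ eigMax hA := sub_nonneg.mp (spr_nonneg hA)
  have hl := posSemidef_sub_eigMin hA
  have hu := posSemidef_eigMax_sub hA
  have hl' : (-A - ((-eigMax hA : ℝ) : ℂ) • 1).PosSemidef := by
    convert hu using 1
    push_cast
    module
  have hu' : (((-eigMin hA : ℝ) : ℂ) • 1 - -A).PosSemidef := by
    convert hl using 1
    push_cast
    module
  have hspr : -eigMin hA - -eigMax hA = spr hA := by
    rw [spr]
    ring
  -- The cut value is the eigenvalue at index `m`, clamped to `n - 1` because `m` may be `n` or
  -- more; in that case the second clause is vacuous.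
  have hcut : ∀ m : ℕ, ∃ c, (∀ i : Fin n, (i : ℕ) < m → c ≤ eigDesc hA i) ∧
      ∀ i : Fin n, m ≤ (i : ℕ) → eigDesc hA i ≤ c := fun m => by
    have hn : 0 < n := NeZero.pos n
    refine ⟨eigDesc hA ⟨min m (n - 1), by omega⟩, fun i hi => eigDesc_antitone hA ?_,
      fun i hi => eigDesc_antitone hA ?_⟩ <;> rw [Fin.le_def] <;> simp <;> omega
  rcases h with (⟨b, m, hb, hS⟩ | ⟨b, m, hb, hS⟩) | h | h
  · obtain ⟨c, hc1, hc2⟩ := hcut m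
    obtain ⟨s1, s2⟩ := separated_of_eigenbasis hA hX hb hS (c := c) (fun i hi => hc1 i hi)
      fun i hi => hc2 i (not_lt.mp hi)
    exact sum_hinge_ritzValues_of_separated hA hXX hY hAX hlu hl hu s1 s2 ht
  · obtain ⟨c, hc1, hc2⟩ := hcut m
    -- For `-A` the same eigenbasis has eigenvalues `-λᵢ`, and the smallest eigenvalues of `A`
    -- become those above the cut `-c`.
    obtain ⟨s1, s2⟩ := separated_of_eigenbasis hA.neg hX (u := b) (d := fun i => - eigDesc hA i)
      (fun i => by
        rw [map_neg, LinearMap.neg_apply, hb]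
        simp) hS (c := -c) (fun i hi => neg_le_neg (hc2 i hi))
      fun i hi => neg_le_neg (hc1 i (not_le.mp hi))
    rw [← sum_hinge_ritzValues_neg hA hA.neg, ← hspr]
    exact sum_hinge_ritzValues_of_separated hA.neg hXX hY (invariant_neg hAX)
      (neg_le_neg hlu) hl' hu' s1 s2 ht
  · exact sum_hinge_ritzValues_of_half hA hXX hY hAX hlu hl hu
      (posSemidef_sub_smul_one _ fun i => (h _ (isEigenvalueOn_ritzValues hA hX hAX i)).1) ht
  · rw [← sum_hinge_ritzValues_neg hA hA.neg, ← hspr]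
    refine sum_hinge_ritzValues_of_half hA.neg hXX hY (invariant_neg hAX)
      (neg_le_neg hlu) hl' hu' ?_ ht
    have := posSemidef_smul_one_sub (isHermitian_conjTranspose_mul_mul X hA)
      fun i => (h _ (isEigenvalueOn_ritzValues hA hX hAX i)).2
    convert this using 1
    rw [compression_neg]
    push_cast
    module

theorem sq_singularValues_toEuclideanLin (C : Matrix (Fin k) (Fin k) ℂ) (i : Fin k) :
    (toEuclideanLin C).singularValues i ^ 2 =
      eigDesc (isHermitian_conjTranspose_mul_self C) i := by
  have hk : Module.finrank ℂ (EuclideanSpace ℂ (Fin k)) = Fintype.card (Fin k) :=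
    finrank_euclideanSpace
  have := (toEuclideanLin C).sq_singularValues_fin hk (Fin.cast (Fintype.card_fin k).symm i)
  rw [Fin.val_cast] at this
  rw [this, eigDesc, IsHermitian.eigenvalues₀]
  have e : (toEuclideanLin C).adjoint ∘ₗ toEuclideanLin C = toEuclideanLin (Cᴴ * C) := by
    rw [← toEuclideanLin_conjTranspose_eq_adjoint]
    exact (toLpLin_mul_same 2 Cᴴ C).symm
  simp only [e]

theorem sin_sq_principalAngles (hX : Xᴴ * X = 1) (hY : Yᴴ * Y = 1) (i : Fin k) :
    Real.sin (principalAngles X Y i) ^ 2 =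
      eigDesc (posSemidef_one_sub_conjTranspose_mul hX hY).1 i := by
  have h1 := sq_singularValues_toEuclideanLin (Xᴴ * Y) i.rev
  have h2 := eigDesc_one_sub (isHermitian_conjTranspose_mul_self (Xᴴ * Y))
    (posSemidef_one_sub_conjTranspose_mul hX hY).1 i
  -- Nonnegativity of `1 - σ²`, with `σ` the singular value, is what makes squaring the root in `sin
  -- (arccos σ)` exact.
  have h3 := eigDesc_nonneg (posSemidef_one_sub_conjTranspose_mul hX hY) i
  rw [principalAngles, Real.sin_arccos, Real.sq_sqrt (by linarith), h1, h2]

end Subspaces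

theorem theorem3p2 {n k : ℕ} [NeZero n] {A : Matrix (Fin n) (Fin n) ℂ} (hA : A.IsHermitian)
    (𝒳 𝒴 : Submodule ℂ (EuclideanSpace ℂ (Fin n))) (X Y : Matrix (Fin n) (Fin k) ℂ)
    (hX : IsOrthonormalBasisMatrix X 𝒳) (hY : IsOrthonormalBasisMatrix Y 𝒴)
    (h : ∃ 𝒵 : Submodule ℂ (EuclideanSpace ℂ (Fin n)), (𝒵 = 𝒳 ∨ 𝒵 = 𝒴) ∧
      IsInvariantSubspace A 𝒵 ∧
      ((CorrespondsToLargest hA 𝒵 ∨ CorrespondsToSmallest hA 𝒵) ∨ InHalfSpectrum hA 𝒵)) :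
    WeakMajorized (fun i => |ritzValues hA X i - ritzValues hA Y i|)
      (fun i => spr hA * Real.sin (principalAngles X Y i) ^ 2) := by
  have hXX := hX.conjTranspose_mul_self
  have hYY := hY.conjTranspose_mul_self
  refine weakMajorized_of_sum_hinge_le (fun i => mul_nonneg (spr_nonneg hA) (sq_nonneg _))
    fun t ht => ?_
  simp only [sin_sq_principalAngles hXX hYY]
  obtain ⟨𝒵, rfl | rfl, hinv, hcases⟩ := h
  · have := sum_hinge_ritzValues_of_invariant hA hX hYY hinv hcases ht
    rwa [eigDesc_one_sub_mul_conjTranspose _ (posSemidef_one_sub_conjTranspose_mul hXX hYY).1]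
      at this
  · have := sum_hinge_ritzValues_of_invariant hA hY hXX hinv hcases ht
    -- Exchanging `X` and `Y` replaces `Xᴴ Y` by its adjoint, so the bound for invariant `𝒴`
    -- involves the same matrix.
    have e : 1 - (Yᴴ * X) * (Yᴴ * X)ᴴ = 1 - (Xᴴ * Y)ᴴ * (Xᴴ * Y) := by
      simp [conjTranspose_mul]
    rw [eigDesc_congr _ (posSemidef_one_sub_conjTranspose_mul hXX hYY).1 e] at this
    simpa only [abs_sub_comm] using this
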